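/- Let $R$ be a commutative ring, $S$ a module-finite $R$-algebra (not necessarily commutative), $M$ a direct summand of a direct sum (over an arbitrary index set) of finitely presented right $S$-modules, and $N$ a finitely generated right $S$-module. For a ring $A$ and right $A$-modules $P, Q$, let $\mathrm{sur}_A(P,Q) \in \{0,1,2,\dots\}\cup\{\infty\}$ denote the supremum of the integers $t \ge 0$ for which there is a surjective $A$-linear map $P \to Q^{\oplus t}$. Let $Y := \mathrm{Max}(R) \cap \mathrm{Supp}_R(N)$, with the topology induced by the Zariski topology of $\mathrm{Spec}(R)$, and let $\dim(Y)$ be its Krull dimension as a topological space, with $\dim(\varnothing) = -\infty$. Suppose that $Y$ is Noetherian and $\dim(Y) < \infty$. Then the following statements hold. 1. Let $t$ be a positive integer, and suppose that $\mathrm{sur}_{S_{\mathfrak m}}(M_{\mathfrak m}, N_{\mathfrak m}) \ge t + \dim(Y)$ for every $\mathfrak m \in Y$. Then $\mathrm{sur}_S(M,N) \ge t$. 2. $\mathrm{sur}_S(M,N) = \infty$ if and only if $\mathrm{sur}_{S_{\mathfrak m}}(M_{\mathfrak m}, N_{\mathfrak m}) = \infty$ for every $\mathfrak m \in Y$. 3.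 Suppose that $\mathrm{sur}_{S_{\mathfrak n}}(M_{\mathfrak n}, N_{\mathfrak n}) < \infty$ for some $\mathfrak n \in Y$. Then $$\mathrm{sur}_S(M,N) \ge \min\{\mathrm{sur}_{S_{\mathfrak m}}(M_{\mathfrak m}, N_{\mathfrak m}) : \mathfrak m \in Y\} - \dim(Y).$$ -/

import Mathlib

open scoped DirectSum

namespace SurCapacity

/-- The global surjective capacity `sur_S(M, N)` of right `S`-modules `M`, `N` (right `S`-modules are
modules over `Sᵐᵒᵖ`): the supremum in `ℕ ∪ {∞}` of the `t ≥ 0` for which there is a surjective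
`S`-linear map from `M` to `N^{⊕ t}`. -/
noncomputable def sur (S M N : Type*) [Ring S] [AddCommGroup M] [AddCommGroup N]
    [Module Sᵐᵒᵖ M] [Module Sᵐᵒᵖ N] : ℕ∞ :=
  sSup {a : ℕ∞ | ∃ t : ℕ, a = t ∧ ∃ f : M →ₗ[Sᵐᵒᵖ] (Fin t → N), Function.Surjective f}

section Localization

variable {R S M : Type*} [CommRing R] [Ring S] [Algebra R S] [AddCommGroup M]
  [Module R M] [Module Sᵐᵒᵖ M] [IsScalarTower R Sᵐᵒᵖ M] (T : Submonoid R)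

/-- `(m / u) · (s / v) = (m · s) / (u v)`. -/
noncomputable def locSMul (x : LocalizedModule T S) (y : LocalizedModule T M) :
    LocalizedModule T M :=
  LocalizedModule.liftOn x
    (fun p => LocalizedModule.liftOn y
      (fun q => LocalizedModule.mk (MulOpposite.op p.1 • q.1) (q.2 * p.2)) (by
        rintro ⟨m, u⟩ ⟨m', u'⟩ ⟨b, hb⟩
        simp only [LocalizedModule.mk_eq, Submonoid.smul_def, Submonoid.coe_mul] at *
        refine ⟨b, ?_⟩
        have h := congrArg (fun z => (p.2 : R) • MulOpposite.op p.1 • z) hb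
        simp only [smul_comm (MulOpposite.op p.1) (_ : R), smul_smul] at h ⊢
        convert h using 2 <;> ring)) (by
    rintro ⟨s, v⟩ ⟨s', v'⟩ ⟨a, ha⟩
    induction y using LocalizedModule.induction_on with
    | _ m u =>
      simp only [LocalizedModule.liftOn_mk, LocalizedModule.mk_eq, Submonoid.smul_def,
        Submonoid.coe_mul] at *
      refine ⟨a, ?_⟩
      have h := congrArg (fun z => (u : R) • MulOpposite.op z • m) ha
      simp only [MulOpposite.op_smul, smul_assoc, smul_smul] at h ⊢
      convert h using 2 <;> ring)

@[simp]
theorem locSMul_mk (s : S) (v : T) (m : M) (u : T) :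
    locSMul T (LocalizedModule.mk s v) (LocalizedModule.mk m u) =
      LocalizedModule.mk (MulOpposite.op s • m) (u * v) :=
  rfl

/-- The localization `T⁻¹M` of a right `S`-module is a right module over the localized ring
`T⁻¹S`. -/
noncomputable instance locModule :
    Module (LocalizedModule T S)ᵐᵒᵖ (LocalizedModule T M) where
  smul x y := locSMul T x.unop y
  one_smul y := by
    change locSMul T 1 y = y
    induction y using LocalizedModule.induction_on with
    | _ m u =>
      rw [OreLocalization.one_def]
      exact (locSMul_mk T 1 1 m u).trans (by simp)
  mul_smul x x' y := by
    obtain ⟨x, rfl⟩ := MulOpposite.op_surjective x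
    obtain ⟨x', rfl⟩ := MulOpposite.op_surjective x'
    change locSMul T (x' * x) y = locSMul T x (locSMul T x' y)
    induction x using LocalizedModule.induction_on with
    | _ s v =>
    induction x' using LocalizedModule.induction_on with
    | _ s' v' =>
    induction y using LocalizedModule.induction_on with
    | _ m u =>
      simp [LocalizedModule.mk_mul_mk, mul_smul, mul_assoc]
  smul_zero x := by
    obtain ⟨x, rfl⟩ := MulOpposite.op_surjective x
    change locSMul T x 0 = 0
    induction x using LocalizedModule.induction_on with
    | _ s v =>
      rw [← LocalizedModule.zero_mk (1 : T), locSMul_mk, smul_zero, LocalizedModule.zero_mk,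
        LocalizedModule.zero_mk]
  smul_add x y y' := by
    obtain ⟨x, rfl⟩ := MulOpposite.op_surjective x
    change locSMul T x (y + y') = locSMul T x y + locSMul T x y'
    induction x using LocalizedModule.induction_on with
    | _ s v =>
    induction y using LocalizedModule.induction_on with
    | _ m u =>
    induction y' using LocalizedModule.induction_on with
    | _ m' u' =>
      simp only [LocalizedModule.mk_add_mk, locSMul_mk, LocalizedModule.mk_eq, Submonoid.smul_def,
        Submonoid.coe_mul]
      refine ⟨1, ?_⟩
      simp only [smul_add, smul_comm (MulOpposite.op s) (_ : R), smul_smul, OneMemClass.coe_one]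
      congr 2 <;> ring
  add_smul x x' y := by
    obtain ⟨x, rfl⟩ := MulOpposite.op_surjective x
    obtain ⟨x', rfl⟩ := MulOpposite.op_surjective x'
    change locSMul T (x + x') y = locSMul T x y + locSMul T x' y
    induction x using LocalizedModule.induction_on with
    | _ s v =>
    induction x' using LocalizedModule.induction_on with
    | _ s' v' =>
    induction y using LocalizedModule.induction_on with
    | _ m u =>
      simp only [LocalizedModule.mk_add_mk, locSMul_mk, LocalizedModule.mk_eq, Submonoid.smul_def,
        Submonoid.coe_mul]
      refine ⟨1, ?_⟩
      simp only [MulOpposite.op_add, MulOpposite.op_smul, add_smul, smul_assoc, smul_add, smul_smul,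
        OneMemClass.coe_one]
      congr 2 <;> ring
  zero_smul y := by
    change locSMul T 0 y = 0
    induction y using LocalizedModule.induction_on with
    | _ m u =>
      rw [← LocalizedModule.zero_mk (1 : T), locSMul_mk, MulOpposite.op_zero, zero_smul,
        LocalizedModule.zero_mk]

end Localization

/-- The local surjective capacity `sur_{S_𝔭}(M_𝔭, N_𝔭)` at a prime `𝔭` of `R`. -/
noncomputable def localSur {R : Type*} (S M N : Type*) [CommRing R] [Ring S] [Algebra R S]
    [AddCommGroup M] [AddCommGroup N] [Module R M] [Module R N] [Module Sᵐᵒᵖ M] [Module Sᵐᵒᵖ N]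
    [IsScalarTower R Sᵐᵒᵖ M] [IsScalarTower R Sᵐᵒᵖ N] (p : PrimeSpectrum R) : ℕ∞ :=
  sur (LocalizedModule p.asIdeal.primeCompl S) (LocalizedModule p.asIdeal.primeCompl M)
    (LocalizedModule p.asIdeal.primeCompl N)

/-- `Max(R) ∩ Supp_R(N)`, as a subset of `Spec R`. -/
def maxSupport (R N : Type*) [CommRing R] [AddCommGroup N] [Module R N] :
    Set (PrimeSpectrum R) :=
  {p | p.asIdeal.IsMaximal} ∩ Module.support R N

/-- `M` is (isomorphic to) a direct summand of `Q`, as a module over `A`. -/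
def IsDirectSummand (A M Q : Type*) [Ring A] [AddCommGroup M] [AddCommGroup Q]
    [Module A M] [Module A Q] : Prop :=
  ∃ (i : M →ₗ[A] Q) (π : Q →ₗ[A] M), π ∘ₗ i = LinearMap.id

end SurCapacity

/-! The proof is a general position argument of basic element type, run inside `Hom_R(M, N)`. Here
`N` is finite over `R`, so Nakayama makes surjectivity of `M → N ^ t` a condition modulo each
maximal ideal in `Y`. The rank at `p` of a submodule `G` of homs is the largest number of its
members that are jointly surjective at `p`.

Finite presentation turns a local surjection at `p` into `S`-linear maps `M → N` jointly surjective
at `p` (`exists_jointSurjAt_of_le_localSur`), so `Hom_S(M, N)` has rank at least `t + dim Y` on `Y`.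
By compactness of `Y`, finitely many homs already do. Generators are then discarded one at a time. A
discard lowers the rank by at most one anywhere (`RankAt.drop`), and it can be arranged not to lower
ranks below the old number of generators at finitely many prescribed points (`exists_reduction`).
With one such point chosen on each relevant irreducible piece of the low-rank loci, their dimension
bounds survive (`RankLociSmall.exists_reduction`). When `t` generators remain, the locus of rank
below `t` is empty, and the generators themselves give the surjection. Only `R`-combinations are
used, so `S`-linearity is preserved. -/

namespace SurCapacity

/-! ### Joint surjectivity and rank at a maximal ideal. -/

section JointSurjectivity

variable {R M N : Type*} [CommRing R] [AddCommGroup M] [Module R M] [AddCommGroup N] [Module R N]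

/-- The map `M → N ^ κ` with components `h i` is surjective after localizing at `p`, in a form that
is meaningful for finite `N`. -/
def JointSurjAt (p : Ideal R) {κ : Type*} (h : κ → M →ₗ[R] N) : Prop :=
  ∃ a ∉ p, ∀ y : κ → N, ∃ x, ∀ i, h i x = a • y i

theorem JointSurjAt.comp_injective {p : Ideal R} {κ κ' : Type*} {h : κ → M →ₗ[R] N}
    (hh : JointSurjAt p h) {e : κ' → κ} (he : Function.Injective e) :
    JointSurjAt p (fun i => h (e i)) := by
  obtain ⟨a, ha, hy⟩ := hh
  refine ⟨a, ha, fun y => ?_⟩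
  obtain ⟨x, hx⟩ := hy (Function.extend e y 0)
  exact ⟨x, fun i => by rw [hx, he.extend_apply]⟩

/-- Nakayama in determinant-trick form: a finite module equal to `m` times itself is killed by some
element congruent to `1` modulo `m`. Applied to the cokernel, this supplies the denominator `a`. -/
theorem jointSurjAt_iff_range_sup [Module.Finite R N] {m : Ideal R} [hm : m.IsMaximal]
    {κ : Type*} [Finite κ] {h : κ → M →ₗ[R] N} :
    JointSurjAt m h ↔
      LinearMap.range (LinearMap.pi h) ⊔ m • (⊤ : Submodule R (κ → N)) = ⊤ := by
  constructor
  · rintro ⟨a, ha, hy⟩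
    refine eq_top_iff.2 fun y _ => ?_
    obtain ⟨b, c, hc, hbc⟩ := hm.exists_inv ha
    obtain ⟨x, hx⟩ := hy y
    have : y = b • LinearMap.pi h x + c • y := by
      funext i
      simp only [Pi.add_apply, Pi.smul_apply, LinearMap.pi_apply, hx, smul_smul, ← add_smul, hbc,
        one_smul]
    rw [this]
    exact Submodule.add_mem_sup (Submodule.smul_mem _ _ ⟨x, rfl⟩)
      (Submodule.smul_mem_smul hc trivial)
  · intro htop
    set L := LinearMap.range (LinearMap.pi h)
    obtain ⟨r, hr, h0⟩ := Submodule.exists_sub_one_mem_and_smul_eq_zero_of_fg_of_le_smul m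
      (⊤ : Submodule R ((κ → N) ⧸ L)) Module.Finite.fg_top (by
        have := congrArg (Submodule.map L.mkQ) htop
        rw [Submodule.map_sup, Submodule.mkQ_map_self, bot_sup_eq, Submodule.map_smul'',
          Submodule.map_top, Submodule.range_mkQ] at this
        exact this.ge)
    refine ⟨r, fun hrm => hm.ne_top ((Ideal.eq_top_iff_one _).2 ?_), fun y => ?_⟩
    · simpa using m.sub_mem hrm hr
    · have := h0 (L.mkQ y) trivial
      rw [← map_smul, Submodule.mkQ_apply, Submodule.Quotient.mk_eq_zero] at this
      obtain ⟨x, hx⟩ := this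
      exact ⟨x, fun i => congrFun hx i⟩

theorem mem_smul_top_pi {κ : Type*} [Finite κ] {m : Ideal R} {y : κ → N}
    (hy : ∀ i, y i ∈ m • (⊤ : Submodule R N)) : y ∈ m • (⊤ : Submodule R (κ → N)) := by
  classical
  cases nonempty_fintype κ
  rw [← LinearMap.sum_single_apply (fun _ : κ => N) y]
  refine Submodule.sum_mem _ fun i _ => ?_
  have : LinearMap.single R (fun _ => N) i (y i) ∈
      (m • (⊤ : Submodule R N)).map (LinearMap.single R (fun _ : κ => N) i) := ⟨_, hy i, rfl⟩
  rw [Submodule.map_smul''] at this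
  exact Submodule.smul_mono le_rfl le_top this

theorem JointSurjAt.congr_mod [Module.Finite R N] {m : Ideal R} [hm : m.IsMaximal]
    {κ : Type*} [Finite κ] {h h' : κ → M →ₗ[R] N} (hh : JointSurjAt m h)
    (hd : ∀ i, h i - h' i ∈ m • (⊤ : Submodule R (M →ₗ[R] N))) : JointSurjAt m h' := by
  rw [jointSurjAt_iff_range_sup] at hh ⊢
  refine eq_top_iff.2 (hh.ge.trans (sup_le ?_ le_sup_right))
  rintro _ ⟨x, rfl⟩
  have : LinearMap.pi h x = LinearMap.pi h' x + fun i => (h i - h' i) x := by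
    funext i; simp
  rw [this]
  refine Submodule.add_mem_sup ⟨x, rfl⟩ (mem_smul_top_pi fun i => ?_)
  have h2 : (LinearMap.applyₗ x) (h i - h' i) ∈
      (m • (⊤ : Submodule R (M →ₗ[R] N))).map (LinearMap.applyₗ x : _ →ₗ[R] N) := ⟨_, hd i, rfl⟩
  rw [Submodule.map_smul''] at h2
  exact Submodule.smul_mono le_rfl le_top h2

/-- `G` contains `r` maps that are jointly surjective at `p`. -/
def RankAt (p : Ideal R) (G : Submodule R (M →ₗ[R] N)) (r : ℕ) : Prop :=
  ∃ h : Fin r → M →ₗ[R] N, (∀ i, h i ∈ G) ∧ JointSurjAt p h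

theorem RankAt.mono {p : Ideal R} {G G' : Submodule R (M →ₗ[R] N)} {r r' : ℕ}
    (h : RankAt p G r) (hG : G ≤ G') (hr : r' ≤ r) : RankAt p G' r' := by
  obtain ⟨f, hf, hs⟩ := h
  exact ⟨_, fun i => hG (hf _), hs.comp_injective (Fin.castLE_injective hr)⟩

/-- Modulo `m` this is elimination of the single vector `g`: if some map involves `g` with a unit
coefficient, that map serves as pivot and is sacrificed. -/
theorem RankAt.drop [Module.Finite R N] {m : Ideal R} [hm : m.IsMaximal]
    {G G' : Submodule R (M →ₗ[R] N)} {g : M →ₗ[R] N} (hG : G ≤ G' ⊔ R ∙ g) {r : ℕ}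
    (h : RankAt m G (r + 1)) : RankAt m G' r := by
  obtain ⟨f, hf, hs⟩ := h
  have : ∀ i, ∃ f' ∈ G', ∃ a : R, f' + a • g = f i := fun i => by
    obtain ⟨y, hy, z, hz, hyz⟩ := Submodule.mem_sup.1 (hG (hf i))
    obtain ⟨a, rfl⟩ := Submodule.mem_span_singleton.1 hz
    exact ⟨y, hy, a, hyz⟩
  choose f' hf' a ha using this
  by_cases hall : ∀ i, a i ∈ m
  · refine RankAt.mono ⟨f', hf', hs.congr_mod fun i => ?_⟩ le_rfl r.le_succ
    rw [← ha, add_sub_cancel_left]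
    exact Submodule.smul_mem_smul (hall i) trivial
  · push Not at hall
    obtain ⟨i₀, hi₀⟩ := hall
    obtain ⟨u, c, hc, huc⟩ := hm.exists_inv hi₀
    have hk : JointSurjAt m (fun j : Fin r => f (i₀.succAbove j) - (u * a (i₀.succAbove j)) • f i₀) := by
      obtain ⟨b, hb, hy⟩ := hs
      refine ⟨b, hb, fun y => ?_⟩
      -- Prescribing `0` in the pivot slot makes the subtracted pivot multiples vanish.
      obtain ⟨x, hx⟩ := hy (i₀.insertNth (α := fun _ => N) 0 y)
      refine ⟨x, fun j => ?_⟩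
      simp [hx]
    refine ⟨fun j => f' (i₀.succAbove j) - (u * a (i₀.succAbove j)) • f' i₀,
      fun j => G'.sub_mem (hf' _) (G'.smul_mem _ (hf' _)), hk.congr_mod fun j => ?_⟩
    have : f (i₀.succAbove j) - (u * a (i₀.succAbove j)) • f i₀ -
        (f' (i₀.succAbove j) - (u * a (i₀.succAbove j)) • f' i₀) =
        (c * a (i₀.succAbove j)) • g := by
      rw [← ha, ← ha, eq_sub_of_add_eq' huc]
      module
    rw [this]
    exact Submodule.smul_mem_smul (m.mul_mem_right _ hc) trivial

/-- There are fewer equations than unknowns over `R ⧸ m`, so a nonzero kernel vector `c` exists. A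
functional whose last coefficient is exactly `1` can be normalised to take the value `1` on `c`;
that coefficient does not depend on `m`, which lets different ideals be interpolated. -/
theorem exists_kernel_vector {m : Ideal R} [hm : m.IsMaximal] {r n : ℕ} (hr : r ≤ n)
    (w : Fin r → Fin (n + 1) → R) :
    ∃ (c : Fin (n + 1) → R) (b : Fin n → R), (∀ i, ∑ j, w i j * c j ∈ m) ∧
      c (Fin.last n) + ∑ j, b j * c j.castSucc - 1 ∈ m := by
  classical
  let _ := Ideal.Quotient.field m
  let W : Matrix (Fin r) (Fin (n + 1)) (R ⧸ m) := fun i j => Ideal.Quotient.mk m (w i j)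
  have hker : LinearMap.ker W.mulVecLin ≠ ⊥ := LinearMap.ker_ne_bot_of_finrank_lt (by simp; omega)
  obtain ⟨v, hv, hv0⟩ := Submodule.exists_mem_ne_zero_of_ne_bot hker
  have hW : ∀ i, ∑ j, Ideal.Quotient.mk m (w i j) * v j = 0 := fun i =>
    congrFun (LinearMap.mem_ker.1 hv) i
  suffices ∃ (c : Fin (n + 1) → R ⧸ m) (b : Fin n → R ⧸ m),
      (∀ i, ∑ j, Ideal.Quotient.mk m (w i j) * c j = 0) ∧
      c (Fin.last n) + ∑ j, b j * c j.castSucc = 1 by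
    obtain ⟨c, b, h1, h2⟩ := this
    obtain ⟨c, rfl⟩ := Ideal.Quotient.mk_surjective.comp_left c
    obtain ⟨b, rfl⟩ := Ideal.Quotient.mk_surjective.comp_left b
    refine ⟨c, b, fun i => ?_, ?_⟩
    · rw [← Ideal.Quotient.eq_zero_iff_mem, ← h1 i]; simp
    · rw [← Ideal.Quotient.eq_zero_iff_mem]; simpa [sub_eq_zero] using h2
  by_cases hl : v (Fin.last n) = 0
  · obtain ⟨j, hj⟩ := Function.ne_iff.1 hv0
    induction j using Fin.lastCases with
    | last => exact absurd hl hj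
    | cast j =>
      refine ⟨v, Pi.single j (v j.castSucc)⁻¹, hW, ?_⟩
      rw [hl, zero_add, Finset.sum_eq_single j]
      · simpa using inv_mul_cancel₀ hj
      · intro k _ hk; simp [hk]
      · simp
  · refine ⟨(v (Fin.last n))⁻¹ • v, 0, fun i => ?_, by simp [hl]⟩
    rw [← mul_zero (v (Fin.last n))⁻¹, ← hW i, Finset.mul_sum]
    exact Finset.sum_congr rfl fun j _ => by simp only [Pi.smul_apply, smul_eq_mul]; ring

/-- Take `g = f_last + ∑ b_j f_j` and `f'_j = f_j - c_j g`. The coefficient `1` of `f_last` makes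
`f'` and `g` generate the old span over `R` itself. At a prescribed point, `W c = 0` and the
normalisation of `c` make `g` cancel modulo `p` from the combinations `W f`. The Chinese remainder
theorem finds `b` and `c` for all points of `F` at once. -/
theorem exists_reduction [Module.Finite R N] {n : ℕ} (f : Fin (n + 1) → M →ₗ[R] N)
    (F : Set (PrimeSpectrum R)) (hF : F.Finite) (hmax : ∀ p ∈ F, p.asIdeal.IsMaximal) :
    ∃ (f' : Fin n → M →ₗ[R] N) (g : M →ₗ[R] N),
      Submodule.span R (Set.range f') ≤ Submodule.span R (Set.range f) ∧
      Submodule.span R (Set.range f) ≤ Submodule.span R (Set.range f') ⊔ R ∙ g ∧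
      ∀ p ∈ F, ∀ r ≤ n, RankAt p.asIdeal (Submodule.span R (Set.range f)) r →
        RankAt p.asIdeal (Submodule.span R (Set.range f')) r := by
  classical
  have key : ∀ p : F, ∃ (c : Fin (n + 1) → R) (b : Fin n → R),
      c (Fin.last n) + ∑ j, b j * c j.castSucc - 1 ∈ p.1.asIdeal ∧
      ∀ r ≤ n, RankAt p.1.asIdeal (Submodule.span R (Set.range f)) r →
        ∃ r', r ≤ r' ∧ ∃ w : Fin r' → Fin (n + 1) → R,
          JointSurjAt p.1.asIdeal (fun i => ∑ j, w i j • f j) ∧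
          ∀ i, ∑ j, w i j * c j ∈ p.1.asIdeal := by
    intro p
    have hp := hmax p.1 p.2
    set Q : ℕ → Prop := fun r => r ≤ n ∧ RankAt p.1.asIdeal (Submodule.span R (Set.range f)) r
    by_cases h0 : ∃ r, Q r
    -- Treating the greatest rank up to `n` lets one choice of `c` and `b` serve every `r ≤ n`.
    · have hQ : Q (Nat.findGreatest Q n) := by
        obtain ⟨r, hr⟩ := h0
        exact Nat.findGreatest_spec hr.1 hr
      obtain ⟨hle, h, hh, hs⟩ := hQ
      have : ∀ i, ∃ w : Fin (n + 1) → R, ∑ j, w j • f j = h i := fun i =>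
        (Submodule.mem_span_range_iff_exists_fun R).1 (hh i)
      choose w hw using this
      obtain ⟨c, b, hc, hb⟩ := exists_kernel_vector (m := p.1.asIdeal) hle w
      refine ⟨c, b, hb, fun r hr hrank => ⟨_, Nat.le_findGreatest hr ⟨hr, hrank⟩, w, ?_, hc⟩⟩
      simpa only [hw] using hs
    · obtain ⟨c, b, -, hb⟩ := exists_kernel_vector (m := p.1.asIdeal) (Nat.zero_le n)
        (fun _ _ => 0)
      exact ⟨c, b, hb, fun r hr hrank => absurd ⟨r, hr, hrank⟩ h0⟩
  choose c b hcb hw using key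
  have := hF.to_subtype
  have hcop : Pairwise (Function.onFun IsCoprime fun p : F => p.1.asIdeal) := fun p q hpq => by
    have h1 := hmax p.1 p.2
    have h2 := hmax q.1 q.2
    exact Ideal.isCoprime_of_isMaximal fun h => hpq (Subtype.ext (PrimeSpectrum.ext h))
  choose c' hc' using fun j => Ideal.exists_forall_sub_mem_ideal hcop fun p => c p j
  choose b' hb' using fun j => Ideal.exists_forall_sub_mem_ideal hcop fun p => b p j
  set g := f (Fin.last n) + ∑ j, b' j • f j.castSucc with hg
  set f' : Fin n → M →ₗ[R] N := fun j => f j.castSucc - c' j.castSucc • g with hf'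
  have hfG : ∀ j, f j ∈ Submodule.span R (Set.range f) := fun j =>
    Submodule.subset_span (Set.mem_range_self j)
  have hfG' : ∀ j, f' j ∈ Submodule.span R (Set.range f') := fun j =>
    Submodule.subset_span (Set.mem_range_self j)
  have hlast : f (Fin.last n) =
      (1 - ∑ j, b' j * c' j.castSucc) • g - ∑ j, b' j • f' j := by
    simp only [hf', smul_sub, Finset.sum_sub_distrib, smul_smul, sub_smul, one_smul,
      Finset.sum_smul]
    rw [hg]; abel
  have hcast : ∀ j : Fin n, f j.castSucc = f' j + c' j.castSucc • g := fun j => by simp [hf']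
  refine ⟨f', g, ?_, ?_, ?_⟩
  · rw [Submodule.span_le]
    rintro _ ⟨j, rfl⟩
    exact Submodule.sub_mem _ (hfG _) (Submodule.smul_mem _ _ (Submodule.add_mem _ (hfG _)
      (Submodule.sum_mem _ fun _ _ => Submodule.smul_mem _ _ (hfG _))))
  · have hgm := Submodule.mem_span_singleton_self (R := R) g
    rw [Submodule.span_le]
    rintro _ ⟨j, rfl⟩
    induction j using Fin.lastCases with
    | last =>
      rw [hlast]
      exact Submodule.sub_mem _ (Submodule.mem_sup_right (Submodule.smul_mem _ _ hgm))
        (Submodule.mem_sup_left (Submodule.sum_mem _ fun _ _ => Submodule.smul_mem _ _ (hfG' _)))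
    | cast j =>
      rw [hcast]
      exact Submodule.add_mem_sup (hfG' j) (Submodule.smul_mem _ _ hgm)
  · intro p hp r hr hrank
    have hpm := hmax p hp
    obtain ⟨r', hrr', w, hs, hwc⟩ := hw ⟨p, hp⟩ r hr hrank
    refine RankAt.mono ⟨fun i => ∑ j : Fin n, (w i j.castSucc - w i (Fin.last n) * b' j) • f' j,
      fun i => Submodule.sum_mem _ fun _ _ => Submodule.smul_mem _ _ (hfG' _), ?_⟩ le_rfl hrr'
    refine hs.congr_mod fun i => ?_
    have e : ∑ j, w i j • f j - ∑ j : Fin n, (w i j.castSucc - w i (Fin.last n) * b' j) • f' j =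
        (∑ j : Fin n, w i j.castSucc * c' j.castSucc +
          w i (Fin.last n) * (1 - ∑ j, b' j * c' j.castSucc)) • g := by
      rw [Fin.sum_univ_castSucc, hlast]
      simp only [hcast, smul_add, Finset.sum_add_distrib, sub_smul, Finset.sum_sub_distrib,
        smul_sub, smul_smul, add_smul, Finset.sum_smul, mul_sub, Finset.smul_sum, Finset.mul_sum]
      abel
    rw [e]
    refine Submodule.smul_mem_smul ?_ trivial
    have h1 := hwc i
    have h2 := hcb ⟨p, hp⟩
    have h3 := fun j => hc' j ⟨p, hp⟩
    have h4 := fun j => hb' j ⟨p, hp⟩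
    simp only [← Ideal.Quotient.eq_zero_iff_mem, map_add, map_sub, map_sum, map_mul,
      map_one, sub_eq_zero] at h1 h2 h3 h4 ⊢
    simp only [h3, h4]
    rw [← h2, add_sub_cancel_right, ← h1, Fin.sum_univ_castSucc]

/-- The jointly surjective maps are `A ∘ f` for a square matrix `A`. Modulo `m`, `A` is a surjective
endomorphism of a finite module, hence injective, so `f` is surjective modulo `m` too. -/
theorem jointSurjAt_of_rankAt_span [Module.Finite R N] {m : Ideal R} [hm : m.IsMaximal] {n : ℕ}
    {f : Fin n → M →ₗ[R] N} (h : RankAt m (Submodule.span R (Set.range f)) n) :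
    JointSurjAt m f := by
  obtain ⟨h, hh, hs⟩ := h
  choose w hw using fun i => (Submodule.mem_span_range_iff_exists_fun R).1 (hh i)
  let A : (Fin n → N) →ₗ[R] (Fin n → N) :=
    LinearMap.pi fun i => ∑ j, w i j • LinearMap.proj j
  have hA : A ∘ₗ LinearMap.pi f = LinearMap.pi h := by
    ext x i
    simp [A, ← hw]
  set I := m • (⊤ : Submodule R (Fin n → N))
  have hAI : I ≤ I.comap A := by
    rw [← Submodule.map_le_iff_le_comap, Submodule.map_smul'']
    exact Submodule.smul_mono le_rfl le_top
  rw [jointSurjAt_iff_range_sup] at hs ⊢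
  set B := I.mapQ I A hAI
  have hB : Function.Surjective (B ∘ₗ I.mkQ ∘ₗ LinearMap.pi f) := by
    intro z
    obtain ⟨y, rfl⟩ := I.mkQ_surjective z
    obtain ⟨_, ⟨x, rfl⟩, v, hv, rfl⟩ := Submodule.mem_sup.1 (hs.ge (Submodule.mem_top (x := y)))
    refine ⟨x, ?_⟩
    rw [map_add, Submodule.mkQ_apply I v, (Submodule.Quotient.mk_eq_zero I).2 hv, add_zero, ← hA]
    rfl
  have hinj := OrzechProperty.injective_of_surjective_endomorphism B (by
    rw [LinearMap.coe_comp] at hB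
    exact hB.of_comp)
  refine eq_top_iff.2 fun y _ => ?_
  obtain ⟨x, hx⟩ := hB (B (I.mkQ y))
  have := (Submodule.Quotient.eq I).1 (hinj hx)
  rw [← sub_sub_cancel (LinearMap.pi f x) y]
  exact Submodule.sub_mem _ (Submodule.mem_sup_left ⟨x, rfl⟩) (Submodule.mem_sup_right this)

theorem surjective_of_jointSurjAt [Module.Finite R N] {κ : Type*} {h : κ → M →ₗ[R] N}
    [Finite κ] (hs : ∀ p ∈ maxSupport R N, JointSurjAt p.asIdeal h) (y : κ → N) :
    ∃ x, ∀ i, h i x = y i := by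
  let L := LinearMap.range (LinearMap.pi h)
  suffices L.colon {y} = ⊤ by
    have h1 : (1 : R) ∈ L.colon {y} := this ▸ trivial
    rw [Submodule.mem_colon_singleton, one_smul] at h1
    obtain ⟨x, hx⟩ := h1
    exact ⟨x, fun i => congrFun hx i⟩
  -- A maximal ideal containing the colon ideal is ruled out by joint surjectivity if it lies in the
  -- support, and by the annihilator of `N` otherwise.
  by_contra hne
  obtain ⟨m, hm, hle⟩ := Ideal.exists_le_maximal _ hne
  by_cases hsupp : (⟨m, hm.isPrime⟩ : PrimeSpectrum R) ∈ Module.support R N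
  · obtain ⟨a, ha, hy⟩ := hs _ ⟨hm, hsupp⟩
    obtain ⟨x, hx⟩ := hy y
    exact ha (hle (Submodule.mem_colon_singleton.2 ⟨x, funext hx⟩))
  · rw [Module.mem_support_iff_of_finite, SetLike.not_le_iff_exists] at hsupp
    obtain ⟨a, ha, ham⟩ := hsupp
    refine ham (hle (Submodule.mem_colon_singleton.2 ?_))
    have : a • y = 0 := funext fun i => Module.mem_annihilator.1 ha _
    rw [this]
    exact L.zero_mem

theorem isOpen_setOf_rankAt (Y : Set (PrimeSpectrum R)) (G : Submodule R (M →ₗ[R] N)) (r : ℕ) :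
    IsOpen {p : Y | RankAt p.1.asIdeal G r} := by
  rw [isOpen_iff_forall_mem_open]
  rintro p ⟨h, hG, a, ha, hy⟩
  exact ⟨{q : Y | a ∉ q.1.asIdeal}, fun q hq => ⟨h, hG, a, hq, hy⟩,
    (PrimeSpectrum.isOpen_basicOpen (a := a)).preimage continuous_subtype_val, ha⟩

end JointSurjectivity

/-! ### Removing generators under dimension bounds. -/

section GeneralPosition

open TopologicalSpace

variable {R M N : Type*} [CommRing R] [AddCommGroup M] [Module R M] [AddCommGroup N] [Module R N]
  [Module.Finite R N]

/-- The locus where `G` has rank less than `j` has dimension less than `j - t`, for `j ≤ n`. -/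
def RankLociSmall (Y : Set (PrimeSpectrum R)) (t n : ℕ) (G : Submodule R (M →ₗ[R] N)) : Prop :=
  ∀ j ≤ n, ∀ X : IrreducibleCloseds Y, (∀ p ∈ X, ¬ RankAt p.1.asIdeal G j) →
    (t : ℕ∞) + Order.height X < j

theorem RankLociSmall.exists_reduction {Y : Set (PrimeSpectrum R)}
    (hmax : ∀ p ∈ Y, p.asIdeal.IsMaximal) [NoetherianSpace Y] {t n : ℕ}
    {f : Fin (n + 1) → M →ₗ[R] N}
    (hf : RankLociSmall Y t (n + 1) (Submodule.span R (Set.range f))) :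
    ∃ f' : Fin n → M →ₗ[R] N,
      Submodule.span R (Set.range f') ≤ Submodule.span R (Set.range f) ∧
      RankLociSmall Y t n (Submodule.span R (Set.range f')) := by
  set G := Submodule.span R (Set.range f)
  have hclosed : ∀ j, IsClosed {p : Y | ¬ RankAt p.1.asIdeal G j} := fun j =>
    (isOpen_setOf_rankAt Y G j).isClosed_compl
  choose S hSfin hSc hSi hSU using fun j =>
    NoetherianSpace.exists_finite_set_isClosed_irreducible (hclosed j)
  -- Each piece of the locus of rank below `j + 1` gets a witness of rank `j`, if it has one, where
  -- the reduction must keep that rank.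
  have hpt : ∀ (j : ℕ) (X : Set Y), ∃ F : Set (PrimeSpectrum R), F.Finite ∧ F ⊆ Y ∧
      ((∃ p ∈ X, RankAt p.1.asIdeal G j) → ∃ p ∈ X, p.1 ∈ F ∧ RankAt p.1.asIdeal G j) := by
    intro j X
    by_cases h : ∃ p ∈ X, RankAt p.1.asIdeal G j
    · obtain ⟨p, hp, hr⟩ := h
      exact ⟨{p.1}, Set.finite_singleton _, by simp, fun _ => ⟨p, hp, rfl, hr⟩⟩
    · exact ⟨∅, Set.finite_empty, by simp, fun h' => absurd h' h⟩
  choose F hFfin hFY hF using hpt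
  obtain ⟨f', g, hle, hle', hrank⟩ := SurCapacity.exists_reduction f
    (⋃ j ∈ Finset.range (n + 1), ⋃ X ∈ S (j + 1), F j X)
    ((Finset.range (n + 1)).finite_toSet.biUnion fun j _ =>
      (hSfin (j + 1)).biUnion fun X _ => hFfin j X)
    (fun p hp => by
      simp only [Set.mem_iUnion] at hp
      obtain ⟨j, -, X, -, hpX⟩ := hp
      exact hmax p (hFY j X hpX))
  refine ⟨f', hle, fun j hj X hX => ?_⟩
  have hsub : (X : Set Y) ⊆ ⋃₀ S (j + 1) := by
    rw [← hSU]
    intro p hp hr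
    have := hmax p.1 p.2
    exact hX p hp (hr.drop hle')
  obtain ⟨X', hX'S, hXX'⟩ := isIrreducible_iff_sUnion_isClosed.1 X.isIrreducible
    (hSfin (j + 1)).toFinset (by simpa using hSc (j + 1)) (by simpa using hsub)
  rw [Set.Finite.mem_toFinset] at hX'S
  let Z : IrreducibleCloseds Y := ⟨X', hSi _ _ hX'S, hSc _ _ hX'S⟩
  have hZ : (t : ℕ∞) + Order.height Z < (j + 1 : ℕ) := hf (j + 1) (by omega) Z fun p hp => by
    have : p ∈ {p : Y | ¬ RankAt p.1.asIdeal G (j + 1)} := by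
      rw [hSU]; exact ⟨X', hX'S, hp⟩
    exact this
  have hXZ : X ≤ Z := hXX'
  have hZj : (t : ℕ∞) + Order.height Z ≤ j := by
    rw [Nat.cast_add_one] at hZ
    exact Order.le_of_lt_add_one hZ
  -- If `X` is the whole piece, a witness on it would contradict `hX`, and without a witness the old
  -- bound for `j` applies. If `X` is a proper subset, its height is strictly smaller, which absorbs
  -- the shift from `j + 1` to `j`.
  rcases hXZ.eq_or_lt with rfl | hlt
  · refine hZj.lt_of_ne fun heq => ?_
    by_cases hr : ∃ p ∈ X', RankAt p.1.asIdeal G j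
    · obtain ⟨p, hp, hpF, hpr⟩ := hF j X' hr
      refine hX p hp (hrank _ ?_ j hj hpr)
      simp only [Set.mem_iUnion]
      exact ⟨j, by simpa using Nat.lt_succ_of_le hj, X', hX'S, hpF⟩
    · push Not at hr
      exact (hf j (by omega) _ hr).ne heq
  · have htop : Order.height Z ≠ ⊤ := fun h => by
      rw [h] at hZj; simp at hZj
    have hXtop : Order.height X < ⊤ := (Order.height_mono hXZ).trans_lt htop.lt_top
    refine lt_of_lt_of_le ?_ hZj
    exact (ENat.add_lt_add_iff_left (ENat.natCast_ne_top t)).2 (Order.height_strictMono hlt hXtop)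

theorem RankLociSmall.exists_of_add {Y : Set (PrimeSpectrum R)}
    (hmax : ∀ p ∈ Y, p.asIdeal.IsMaximal) [NoetherianSpace Y] {t : ℕ} (n : ℕ)
    {f : Fin (t + n) → M →ₗ[R] N}
    (hf : RankLociSmall Y t (t + n) (Submodule.span R (Set.range f))) :
    ∃ h : Fin t → M →ₗ[R] N, (∀ i, h i ∈ Submodule.span R (Set.range f)) ∧
      ∀ p ∈ Y, JointSurjAt p.asIdeal h := by
  induction n with
  | zero =>
    refine ⟨f, fun i => Submodule.subset_span ⟨i, rfl⟩, fun p hp => ?_⟩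
    have := hmax p hp
    refine jointSurjAt_of_rankAt_span ?_
    by_contra hr
    have hcl : IsClosed {q : Y | ¬ RankAt q.1.asIdeal (Submodule.span R (Set.range f)) t} :=
      (isOpen_setOf_rankAt Y _ t).isClosed_compl
    -- A point of rank below `t` would give an irreducible closed set with `t + height < t`.
    refine absurd (hf t le_rfl ⟨closure {⟨p, hp⟩}, isIrreducible_singleton.closure,
      isClosed_closure⟩ fun q hq => ?_) (by simp)
    exact (closure_minimal (Set.singleton_subset_iff.2 hr) hcl) hq
  | succ n ih =>
    obtain ⟨f', hle, hf'⟩ := RankLociSmall.exists_reduction (n := t + n) hmax hf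
    obtain ⟨h, hh, hs⟩ := ih hf'
    exact ⟨h, fun i => hle (hh i), hs⟩

theorem exists_surjective_of_rankAt {Y : Set (PrimeSpectrum R)} (hY : Y = maxSupport R N)
    [NoetherianSpace Y] (H : Submodule R (M →ₗ[R] N)) (t d : ℕ)
    (hd : ∀ X : IrreducibleCloseds Y, Order.height X ≤ d)
    (hrank : ∀ p ∈ Y, RankAt p.asIdeal H (t + d)) :
    ∃ h : Fin t → M →ₗ[R] N, (∀ i, h i ∈ H) ∧ ∀ y : Fin t → N, ∃ x, ∀ i, h i x = y i := by
  classical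
  have hmax : ∀ p ∈ Y, p.asIdeal.IsMaximal := fun p hp => by rw [hY] at hp; exact hp.1
  choose! h hH hs using hrank
  have hgen : ∀ p ∈ Y, RankAt p.asIdeal (Submodule.span R (Set.range (h p))) (t + d) :=
    fun p hp => ⟨h p, fun i => Submodule.subset_span ⟨i, rfl⟩, hs p hp⟩
  obtain ⟨T, hT⟩ := (isCompact_univ (X := Y)).elim_finite_subcover
    (fun p : Y => {q : Y | RankAt q.1.asIdeal (Submodule.span R (Set.range (h p.1))) (t + d)})
    (fun p => isOpen_setOf_rankAt Y _ _)
    (fun p _ => Set.mem_iUnion.2 ⟨p, hgen p.1 p.2⟩)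
  let s : Finset (M →ₗ[R] N) := T.biUnion fun p => Finset.univ.image (h p.1)
  have hsH : ∀ x ∈ s, x ∈ H := fun x hx => by
    simp only [s, Finset.mem_biUnion, Finset.mem_image] at hx
    obtain ⟨p, -, i, -, rfl⟩ := hx
    exact hH p.1 p.2 i
  let e := s.equivFin
  -- Padding by `t` zero maps puts the number of generators in the form `t + n` without changing the
  -- span.
  let f : Fin (t + s.card) → M →ₗ[R] N := Fin.append (fun _ => 0) fun i => (e.symm i : M →ₗ[R] N)
  have hfH : Submodule.span R (Set.range f) ≤ H := by
    rw [Submodule.span_le]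
    rintro _ ⟨i, rfl⟩
    induction i using Fin.addCases with
    | left i => simp [f]
    | right i => simpa [f] using hsH _ (e.symm i).2
  have hsf : ∀ x ∈ s, x ∈ Submodule.span R (Set.range f) := fun x hx =>
    Submodule.subset_span ⟨Fin.natAdd t (e ⟨x, hx⟩), by simp [f]⟩
  have hG : ∀ p ∈ Y, RankAt p.asIdeal (Submodule.span R (Set.range f)) (t + d) := fun p hp => by
    obtain ⟨q, hq⟩ := Set.mem_iUnion.1 (hT (Set.mem_univ (⟨p, hp⟩ : Y)))
    obtain ⟨hqT, hr⟩ := Set.mem_iUnion.1 hq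
    refine RankAt.mono hr ?_ le_rfl
    rw [Submodule.span_le]
    rintro _ ⟨i, rfl⟩
    exact hsf _ (Finset.mem_biUnion.2 ⟨q, hqT, Finset.mem_image_of_mem _ (Finset.mem_univ i)⟩)
  -- The initial bounds: the locus is empty for `j ≤ t + d`, and the dimension bound `d` suffices
  -- for larger `j`.
  obtain ⟨g, hg, hgs⟩ := RankLociSmall.exists_of_add hmax (t := t) s.card (f := f) (by
    intro j _ X hX
    obtain ⟨p, hp⟩ := X.isIrreducible.nonempty
    have hj : t + d < j := by
      by_contra hj
      exact hX p hp ((hG p.1 p.2).mono le_rfl (not_lt.1 hj))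
    calc (t : ℕ∞) + Order.height X ≤ t + d := by gcongr; exact hd X
      _ < j := by exact_mod_cast hj)
  exact ⟨g, fun i => hfH (hg i), surjective_of_jointSurjAt fun p hp => hgs p (hY ▸ hp)⟩

end GeneralPosition

/-! ### Capacities as attained bounds. -/

section Capacity

theorem natCast_le_sur_iff {S M N : Type*} [Ring S] [AddCommGroup M] [AddCommGroup N]
    [Module Sᵐᵒᵖ M] [Module Sᵐᵒᵖ N] {t : ℕ} :
    (t : ℕ∞) ≤ sur S M N ↔ ∃ f : M →ₗ[Sᵐᵒᵖ] (Fin t → N), Function.Surjective f := by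
  refine ⟨fun h => ?_, fun ⟨f, hf⟩ => le_sSup ⟨t, rfl, f, hf⟩⟩
  obtain _ | t := t
  · exact ⟨0, fun y => ⟨0, Subsingleton.elim _ _⟩⟩
  · have hlt : (t : ℕ∞) < sur S M N := lt_of_lt_of_le (by exact_mod_cast t.lt_succ_self) h
    obtain ⟨_, ⟨t', rfl, f, hf⟩, htt'⟩ := lt_sSup_iff.1 hlt
    have hle : t + 1 ≤ t' := by exact_mod_cast htt'
    refine ⟨LinearMap.funLeft Sᵐᵒᵖ N (Fin.castLE hle) ∘ₗ f, ?_⟩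
    rw [LinearMap.coe_comp]
    exact (LinearMap.funLeft_surjective_of_injective _ _ _ (Fin.castLE_injective hle)).comp hf

theorem sur_eq_top_iff {S M N : Type*} [Ring S] [AddCommGroup M] [AddCommGroup N]
    [Module Sᵐᵒᵖ M] [Module Sᵐᵒᵖ N] : sur S M N = ⊤ ↔ ∀ t : ℕ, (t : ℕ∞) ≤ sur S M N := by
  rw [ENat.eq_top_iff_forall_ge]

end Capacity

/-! ### Clearing denominators. -/

section Lifting

variable {R A M N : Type*} [CommRing R] [Ring A] [Algebra R A] [AddCommGroup N] [Module R N]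
  [Module A N] [IsScalarTower R A N] (T : Submonoid R)

/-- Homomorphisms from a finitely presented module into a localization lift, up to a denominator,
and the denominator may be replaced by any of its multiples. -/
theorem exists_lift_of_finitePresentation {P : Type*} [AddCommGroup P] [Module A P]
    [hP : Module.FinitePresentation A P] (ψ : P →+ LocalizedModule T N)
    (hψ : ∀ (a : A) (x : P) (n : N) (u : T), ψ x = LocalizedModule.mk n u →
      ψ (a • x) = LocalizedModule.mk (a • n) u) :
    ∃ w : T, ∀ w' : T, w ∣ w' →
      ∃ h : P →ₗ[A] N, ∀ x, LocalizedModule.mk (h x) 1 = (w' : R) • ψ x := by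
  obtain ⟨s, hs, r, hr⟩ := hP.out
  set p := Finsupp.linearCombination A ((↑) : s → P)
  have hp : Function.Surjective p := by
    rw [← LinearMap.range_eq_top, Finsupp.range_linearCombination]
    simpa using hs
  obtain ⟨v, hv⟩ := IsLocalizedModule.exist_integer_multiples_of_finite T
    (LocalizedModule.mkLinearMap T N) fun e : s => ψ e
  choose y hy using hv
  simp only [LocalizedModule.mkLinearMap_apply] at hy
  have hmk : ∀ (n : N) (z : LocalizedModule T N),
      LocalizedModule.mk n 1 = (v : R) • z ↔ z = LocalizedModule.mk n v := by
    intro n z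
    rw [← LocalizedModule.mk_cancel v n, Submonoid.smul_def, ← LocalizedModule.smul'_mk,
      ← Submonoid.smul_def, ← Submonoid.smul_def,
      (IsLocalizedModule.smul_injective (LocalizedModule.mkLinearMap T N) v).eq_iff, eq_comm]
  let g : (s →₀ A) →ₗ[A] N := Finsupp.linearCombination A y
  have hg : ∀ z, LocalizedModule.mk (g z) 1 = (v : R) • ψ (p z) := by
    intro z
    induction z using Finsupp.induction_linear with
    | zero => simp
    | add z z' hz hz' =>
      rw [map_add, map_add, map_add, smul_add, ← hz, ← hz', ← LocalizedModule.mkLinearMap_apply,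
        map_add]
      rfl
    | single e a =>
      rw [Finsupp.linearCombination_single, Finsupp.linearCombination_single, hmk]
      exact hψ a _ _ _ ((hmk _ _).1 (hy e))
  have hker : ∀ z ∈ r, ∃ c : T, (c : R) • g z = 0 := by
    intro z hz
    have hz0 : p z = 0 := hr.le (Submodule.subset_span hz)
    have h0 := hg z
    rw [hz0, map_zero, smul_zero, ← LocalizedModule.mkLinearMap_apply,
      IsLocalizedModule.eq_zero_iff T] at h0
    exact h0
  choose! c hc using hker
  -- `v` clears denominators on the generators; the product kills the finitely many relations.
  refine ⟨(∏ z ∈ r, c z) * v, ?_⟩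
  rintro _ ⟨w, rfl⟩
  set b := (∏ z ∈ r, c z) * w
  let G : (s →₀ A) →ₗ[A] N := (b : R) • g
  have hG : LinearMap.ker p ≤ LinearMap.ker G := by
    rw [← hr, Submodule.span_le]
    intro z hz
    obtain ⟨q, hq⟩ := (Finset.dvd_prod_of_mem c hz).mul_right w
    have : (b : R) • g z = 0 := by
      rw [show b = c z * q from hq, Submonoid.coe_mul, mul_comm, mul_smul, hc z hz, smul_zero]
    exact this
  refine ⟨(LinearMap.ker p).liftQ G hG ∘ₗ (p.quotKerEquivOfSurjective hp).symm, fun x => ?_⟩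
  obtain ⟨z, rfl⟩ := hp x
  have : (p.quotKerEquivOfSurjective hp).symm (p z) = (LinearMap.ker p).mkQ z := by
    rw [LinearEquiv.symm_apply_eq]; rfl
  rw [LinearMap.comp_apply, LinearEquiv.coe_coe, this, Submodule.mkQ_apply, Submodule.liftQ_apply,
    LinearMap.smul_apply, ← LocalizedModule.smul'_mk, hg, smul_smul, ← Submonoid.coe_mul]
  rw [show b * v = (∏ z ∈ r, c z) * v * w from mul_right_comm _ _ _]

theorem jointSurjAt_of_generators [AddCommGroup M] [Module R M] {p : Ideal R} [hp : p.IsPrime]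
    {κ : Type*} [Finite κ] [DecidableEq κ] {h : κ → M →ₗ[R] N} (s : Finset N)
    (hs : Submodule.span R (s : Set N) = ⊤)
    (hgen : ∀ j, ∀ n ∈ s, ∃ a ∉ p, ∃ x, ∀ i, h i x = a • Pi.single (M := fun _ => N) j n i) :
    JointSurjAt p h := by
  cases nonempty_fintype κ
  choose! a ha x hx using hgen
  set b := ∏ j, ∏ n ∈ s, a j n
  refine ⟨b, ?_, ?_⟩
  · simp only [b, hp.prod_mem_iff, not_exists, not_and]
    exact fun j _ n hn => ha j n hn
  · let L : Submodule R (κ → N) :=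
      (LinearMap.range (LinearMap.pi h)).comap (b • LinearMap.id)
    have hL : ∀ j n, Pi.single j n ∈ L := by
      intro j
      have : (⊤ : Submodule R N) ≤ L.comap (LinearMap.single R (fun _ => N) j) := by
        rw [← hs, Submodule.span_le]
        intro n hn
        obtain ⟨q, hq⟩ := (Finset.dvd_prod_of_mem (a j) hn).trans
          (Finset.dvd_prod_of_mem (fun j => ∏ n ∈ s, a j n) (Finset.mem_univ j))
        refine ⟨q • x j n, funext fun i => ?_⟩
        change h i (q • x j n) = b • Pi.single (M := fun _ => N) j n i
        rw [map_smul, hx j n hn, smul_smul, mul_comm]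
        exact congrArg (· • _) hq.symm
      exact fun n => this trivial
    intro y
    have hy : y ∈ L := by
      rw [← LinearMap.sum_single_apply (fun _ : κ => N) y]
      exact L.sum_mem fun j _ => hL j _
    obtain ⟨x, hx⟩ := hy
    exact ⟨x, fun i => congrFun hx i⟩

end Lifting

/-! ### Passage between local and global maps. -/

section LocalCapacity

variable {R S M N ι : Type*} {P : ι → Type*}
    [CommRing R] [Ring S] [Algebra R S]
    [AddCommGroup M] [Module R M] [Module Sᵐᵒᵖ M] [IsScalarTower R Sᵐᵒᵖ M]
    [AddCommGroup N] [Module R N] [Module Sᵐᵒᵖ N] [IsScalarTower R Sᵐᵒᵖ N]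

/-- The localization of a homomorphism of right `S`-modules, as a homomorphism of right modules over
the localized ring. -/
noncomputable def locMap (T : Submonoid R) (f : M →ₗ[Sᵐᵒᵖ] N) :
    LocalizedModule T M →ₗ[(LocalizedModule T S)ᵐᵒᵖ] LocalizedModule T N where
  toFun := IsLocalizedModule.map T (LocalizedModule.mkLinearMap T M)
    (LocalizedModule.mkLinearMap T N) (f.restrictScalars R)
  map_add' := map_add _
  map_smul' := by
    intro x y
    obtain ⟨x, rfl⟩ := MulOpposite.op_surjective x
    induction x using LocalizedModule.induction_on with
    | _ s v =>
    induction y using LocalizedModule.induction_on with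
    | _ m u =>
      change IsLocalizedModule.map T _ _ _ (LocalizedModule.mk (MulOpposite.op s • m) (u * v)) =
        locSMul T (LocalizedModule.mk s v) _
      simp only [IsLocalizedModule.mk_eq_mk' _ m, IsLocalizedModule.mk_eq_mk' _ (_ • m),
        IsLocalizedModule.map_mk']
      simp only [← IsLocalizedModule.mk_eq_mk', locSMul_mk, LinearMap.coe_restrictScalars, map_smul]

theorem locMap_mk (T : Submonoid R) (f : M →ₗ[Sᵐᵒᵖ] N) (m : M) (u : T) :
    locMap T f (LocalizedModule.mk m u) = LocalizedModule.mk (f m) u := by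
  change IsLocalizedModule.map T _ _ _ _ = _
  simp only [IsLocalizedModule.mk_eq_mk', IsLocalizedModule.map_mk', LinearMap.coe_restrictScalars]

theorem natCast_le_localSur {p : PrimeSpectrum R} {t : ℕ} (h : (t : ℕ∞) ≤ sur S M N) :
    (t : ℕ∞) ≤ localSur S M N p := by
  obtain ⟨f, hf⟩ := natCast_le_sur_iff.1 h
  refine natCast_le_sur_iff.2 ⟨LinearMap.pi fun i => locMap _ (LinearMap.proj i ∘ₗ f), fun z => ?_⟩
  obtain ⟨v, hv⟩ := IsLocalizedModule.exist_integer_multiples_of_finite p.asIdeal.primeCompl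
    (LocalizedModule.mkLinearMap p.asIdeal.primeCompl N) z
  choose y hy using hv
  obtain ⟨x, hx⟩ := hf y
  refine ⟨LocalizedModule.mk x v, funext fun i => ?_⟩
  rw [LinearMap.pi_apply, locMap_mk, LinearMap.comp_apply, hx, LinearMap.proj_apply,
    IsLocalizedModule.mk_eq_mk', IsLocalizedModule.mk'_eq_iff, hy]
  rfl

theorem op_mk_one_smul (T : Submonoid R) (a : Sᵐᵒᵖ) (m : M) (u : T) :
    MulOpposite.op (LocalizedModule.mk a.unop (1 : T)) • (LocalizedModule.mk m u) =
      LocalizedModule.mk (a • m) u := by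
  refine (locSMul_mk T _ _ _ _).trans ?_
  rw [mul_one, MulOpposite.op_unop]

theorem op_algebraMap_smul (T : Submonoid R) (r : R) (x : LocalizedModule T M) :
    MulOpposite.op (LocalizedModule.mk (algebraMap R S r) (1 : T)) • x = r • x := by
  induction x using LocalizedModule.induction_on with
  | _ m u =>
    have := op_mk_one_smul T (algebraMap R Sᵐᵒᵖ r) m u
    rw [algebraMap_smul] at this
    rw [LocalizedModule.smul'_mk, ← this]
    rfl

/-- Only preimages of the finitely many vectors with one generator of `N` in one slot need be
controlled. Their images in the direct sum have finite support, so the local map is lifted on those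
summands with a common denominator and set to zero on the others. This is why the index set may be
arbitrary. -/
theorem exists_jointSurjAt_of_le_localSur [∀ i, AddCommGroup (P i)] [∀ i, Module Sᵐᵒᵖ (P i)]
    (hP : ∀ i, Module.FinitePresentation Sᵐᵒᵖ (P i)) (hM : IsDirectSummand Sᵐᵒᵖ M (⨁ i, P i))
    [hN : Module.Finite R N] {p : PrimeSpectrum R} {t : ℕ} (h : (t : ℕ∞) ≤ localSur S M N p) :
    ∃ f : Fin t → M →ₗ[Sᵐᵒᵖ] N, JointSurjAt p.asIdeal fun i => (f i).restrictScalars R := by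
  classical
  let T := p.asIdeal.primeCompl
  obtain ⟨φ, hφ⟩ : ∃ φ : LocalizedModule T M →ₗ[(LocalizedModule T S)ᵐᵒᵖ]
    (Fin t → LocalizedModule T N), Function.Surjective φ := natCast_le_sur_iff.1 h
  obtain ⟨incl, π, hπ⟩ := hM
  obtain ⟨s, hs⟩ := hN.fg_top
  have hφR : ∀ (r : R) x, φ (r • x) = r • φ x := fun r x => by
    rw [← op_algebraMap_smul (S := S), map_smul]
    exact funext fun i => op_algebraMap_smul T r (φ x i)
  have hpre : ∀ (j : Fin t) (n : N), ∃ (μ : M) (v : T), ∀ i,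
      φ (LocalizedModule.mk μ 1) i =
        (v : R) • LocalizedModule.mk (Pi.single (M := fun _ => N) j n i) 1 := by
    intro j n
    obtain ⟨ξ, hξ⟩ := hφ fun i => LocalizedModule.mk (Pi.single (M := fun _ => N) j n i) 1
    induction ξ using LocalizedModule.induction_on with
    | _ μ v =>
      refine ⟨μ, v, fun i => ?_⟩
      rw [← LocalizedModule.mk_cancel v μ, Submonoid.smul_def, ← LocalizedModule.smul'_mk, hφR, hξ]
      rfl
  choose μ v hμ using hpre
  let F : Finset ι := Finset.univ.biUnion fun j : Fin t => s.biUnion fun n =>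
    DFinsupp.support (incl (μ j n))
  let ψ : ∀ k : ι, Fin t → P k →+ LocalizedModule T N := fun k i =>
    { toFun := fun x => φ (LocalizedModule.mkLinearMap T M
        (π (DirectSum.lof Sᵐᵒᵖ ι P k x))) i
      map_zero' := by simp
      map_add' := fun x y => by simp only [map_add, Pi.add_apply] }
  have hψ : ∀ k i (a : Sᵐᵒᵖ) (x : P k) (n : N) (u : T), ψ k i x = LocalizedModule.mk n u →
      ψ k i (a • x) = LocalizedModule.mk (a • n) u := by
    intro k i a x n u hx
    change φ (LocalizedModule.mk (π (DirectSum.lof Sᵐᵒᵖ ι P k (a • x))) 1) i = _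
    rw [map_smul, map_smul, ← op_mk_one_smul, map_smul, Pi.smul_apply]
    rw [← op_mk_one_smul, ← hx]
    rfl
  choose w hw using fun k i => exists_lift_of_finitePresentation T (ψ k i) (hψ k i)
  set W := ∏ k ∈ F, ∏ i, w k i
  have hlift : ∀ k i, ∃ g : P k →ₗ[Sᵐᵒᵖ] N, k ∈ F →
      ∀ x, LocalizedModule.mk (g x) 1 = (W : R) • ψ k i x := by
    intro k i
    by_cases hk : k ∈ F
    · obtain ⟨g, hg⟩ := hw k i W ((Finset.dvd_prod_of_mem _ (Finset.mem_univ i)).trans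
        (Finset.dvd_prod_of_mem (fun k => ∏ i, w k i) hk))
      exact ⟨g, fun _ => hg⟩
    · exact ⟨0, fun hk' => absurd hk' hk⟩
  choose g hg using hlift
  let G : Fin t → (⨁ k, P k) →ₗ[Sᵐᵒᵖ] N := fun i => DirectSum.toModule Sᵐᵒᵖ ι N fun k => g k i
  have hG : ∀ i (z : ⨁ k, P k), DFinsupp.support z ⊆ F →
      LocalizedModule.mk (G i z) 1 = (W : R) • φ (LocalizedModule.mk (π z) 1) i := by
    intro i z hz
    rw [← LocalizedModule.mkLinearMap_apply, ← LocalizedModule.mkLinearMap_apply]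
    conv_lhs => rw [← DirectSum.sum_support_of z]
    conv_rhs => rw [← DirectSum.sum_support_of z]
    simp only [map_sum, Finset.sum_apply, Finset.smul_sum]
    refine Finset.sum_congr rfl fun k hk => ?_
    have : G i (DirectSum.of P k (z k)) = g k i (z k) := DirectSum.toModule_lof _ _ _
    rw [this]
    exact hg k i (hz hk) (z k)
  refine ⟨fun i => G i ∘ₗ incl, jointSurjAt_of_generators s hs fun j n hn => ?_⟩
  have hsupp : DFinsupp.support (incl (μ j n)) ⊆ F := fun k hk =>
    Finset.mem_biUnion.2 ⟨j, Finset.mem_univ j, Finset.mem_biUnion.2 ⟨n, hn, hk⟩⟩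
  have heq : ∀ i, ∃ c : T, (c : R) • G i (incl (μ j n)) =
      (c : R) • ((W : R) * v j n) • Pi.single (M := fun _ => N) j n i := by
    intro i
    have h1 := hG i _ hsupp
    rw [show π (incl (μ j n)) = μ j n from LinearMap.congr_fun hπ _, hμ, smul_smul,
      LocalizedModule.smul'_mk, LocalizedModule.mk_eq] at h1
    obtain ⟨c, hc⟩ := h1
    exact ⟨c, by rw [one_smul, one_smul] at hc; exact hc⟩
  choose c hc using heq
  let C : T := ∏ i, c i
  refine ⟨(C : R) * (W * v j n), (C * (W * v j n)).2, (C : R) • μ j n, fun i => ?_⟩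
  rw [map_smul]
  change (C : R) • G i (incl (μ j n)) = _
  obtain ⟨q, hq⟩ := Finset.dvd_prod_of_mem c (Finset.mem_univ i)
  rw [mul_smul, show C = c i * q from hq, mul_comm, Submonoid.coe_mul, mul_smul, hc i, ← mul_smul]

end LocalCapacity

end SurCapacity

/-! ### The three statements. -/

open SurCapacity in
theorem theorem0p3 {R S M N ι : Type*} {P : ι → Type*}
    [CommRing R] [Ring S] [Algebra R S] [Module.Finite R S]
    [AddCommGroup M] [Module R M] [Module Sᵐᵒᵖ M] [IsScalarTower R Sᵐᵒᵖ M]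
    [AddCommGroup N] [Module R N] [Module Sᵐᵒᵖ N] [IsScalarTower R Sᵐᵒᵖ N]
    [∀ i, AddCommGroup (P i)] [∀ i, Module Sᵐᵒᵖ (P i)]
    (hP : ∀ i, Module.FinitePresentation Sᵐᵒᵖ (P i))
    (hM : SurCapacity.IsDirectSummand Sᵐᵒᵖ M (⨁ i, P i))
    (hN : Module.Finite Sᵐᵒᵖ N)
    (Y : Set (PrimeSpectrum R)) (hY : Y = SurCapacity.maxSupport R N)
    (hNoeth : TopologicalSpace.NoetherianSpace Y)
    (hdim : topologicalKrullDim Y < ⊤) :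
    -- (1)
    (∀ t : ℕ, 0 < t →
      (∀ m ∈ Y, (t : WithBot ℕ∞) + topologicalKrullDim Y ≤
        (SurCapacity.localSur S M N m : WithBot ℕ∞)) →
      (t : ℕ∞) ≤ SurCapacity.sur S M N) ∧
    -- (2)
    (SurCapacity.sur S M N = ⊤ ↔ ∀ m ∈ Y, SurCapacity.localSur S M N m = ⊤) ∧
    -- (3): the minimum `k` exists and is finite, and `k - dim Y ≤ sur_S(M, N)`, written without
    -- subtraction (here `Y` is nonempty, so `dim Y` is a natural number)
    ((∃ n ∈ Y, SurCapacity.localSur S M N n < ⊤) →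
      ∃ k : ℕ, IsLeast (SurCapacity.localSur S M N '' Y) (k : ℕ∞) ∧
        (k : WithBot ℕ∞) ≤
          (SurCapacity.sur S M N : WithBot ℕ∞) + topologicalKrullDim Y) := by
  have : Module.Finite R Sᵐᵒᵖ := Module.Finite.equiv (MulOpposite.opLinearEquiv R)
  have : Module.Finite R N := Module.Finite.trans Sᵐᵒᵖ N
  -- For empty `Y` the value `d = 0` stands in for `-∞`, hence the nonemptiness guard.
  obtain ⟨d, hd, hdY⟩ : ∃ d : ℕ, (∀ X : TopologicalSpace.IrreducibleCloseds Y,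
      Order.height X ≤ d) ∧ (Y.Nonempty → topologicalKrullDim Y = d) := by
    rcases hk : topologicalKrullDim Y with _ | _ | d
    · have := Order.krullDim_eq_bot_iff.1 hk
      refine ⟨0, fun X => isEmptyElim X, fun ⟨p, hp⟩ => ?_⟩
      exact isEmptyElim (⟨closure {⟨p, hp⟩}, isIrreducible_singleton.closure,
        isClosed_closure⟩ : TopologicalSpace.IrreducibleCloseds Y)
    · exact absurd hk hdim.ne
    · refine ⟨d, fun X => ?_, fun _ => rfl⟩
      have := Order.height_le_krullDim X
      rw [← topologicalKrullDim, hk] at this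
      exact WithBot.coe_le_coe.1 this
  have main : ∀ t : ℕ, (∀ m ∈ Y, ((t + d : ℕ) : ℕ∞) ≤ localSur S M N m) →
      (t : ℕ∞) ≤ sur S M N := by
    intro t ht
    obtain ⟨h, hh, hs⟩ := exists_surjective_of_rankAt hY
      (LinearMap.range (LinearMap.restrictScalarsₗ R Sᵐᵒᵖ M N R)) t d hd fun p hp => by
        obtain ⟨f, hf⟩ := exists_jointSurjAt_of_le_localSur hP hM (ht p hp)
        exact ⟨_, fun i => ⟨f i, rfl⟩, hf⟩
    choose f hf using hh
    refine natCast_le_sur_iff.2 ⟨LinearMap.pi f, fun y => ?_⟩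
    obtain ⟨x, hx⟩ := hs y
    exact ⟨x, funext fun i => by rw [← hx i, ← hf i]; rfl⟩
  refine ⟨fun t _ ht => main t fun m hm => ?_, ⟨fun h m _ => ?_, fun h => ?_⟩, ?_⟩
  · have := ht m hm
    rw [hdY ⟨m, hm⟩] at this
    exact_mod_cast this
  · rw [localSur, sur_eq_top_iff]
    exact fun t => natCast_le_localSur (by rw [h]; exact le_top)
  · rw [sur_eq_top_iff]
    exact fun t => main t fun m hm => by rw [h m hm]; exact le_top
  · rintro ⟨n, hn, hlt⟩
    have hne : (localSur S M N '' Y).Nonempty := ⟨_, n, hn, rfl⟩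
    have hmem := csInf_mem hne
    have hle : ∀ m ∈ Y, sInf (localSur S M N '' Y) ≤ localSur S M N m := fun m hm =>
      sInf_le ⟨m, hm, rfl⟩
    obtain ⟨k, hk⟩ := ENat.ne_top_iff_exists.1 ((hle n hn).trans_lt hlt).ne
    rw [← hk] at hmem hle
    refine ⟨k, ⟨hmem, by rintro _ ⟨m, hm, rfl⟩; exact hle m hm⟩, ?_⟩
    rw [hdY ⟨n, hn⟩]
    -- Truncated subtraction: for `k < d` the bound is `0` and nothing is needed.
    have hkd : ((k - d : ℕ) : ℕ∞) ≤ sur S M N := by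
      by_cases hdk : d ≤ k
      · exact main _ fun m hm => by rw [Nat.sub_add_cancel hdk]; exact hle m hm
      · rw [Nat.sub_eq_zero_of_le (not_le.1 hdk).le]; simp
    have : (k : ℕ∞) ≤ sur S M N + d := by
      have hk' : k ≤ k - d + d := by omega
      exact (Nat.cast_le.2 hk').trans ((Nat.cast_add _ _).le.trans (add_le_add_left hkd d))
    exact_mod_cast this
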